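/- Consider a static stochastic team with $N$ decision makers: a probability space $(\Omega,\mathcal F,P)$; a measurable exogenous variable $\omega_0:\Omega\to\Omega_0$ with values in a measurable space $\Omega_0$; for $k=1,\dots,N$ standard Borel (Polish) measurement and action spaces $\mathbb Y^k,\mathbb U^k$ with $\mathbb U^k\neq\emptyset$; measurable measurements $y^k=\eta^k(\omega)$, which are not affected by any action; and a measurable cost $c:\Omega_0\times\prod_k\mathbb U^k\to\mathbb R_+$. An (admissible, deterministic) team policy is a tuple $\underline\gamma=(\gamma^1,\dots,\gamma^N)$ of measurable maps $\gamma^k:\mathbb Y^k\to\mathbb U^k$; its cost is $J(\underline\gamma)=E[c(\omega_0,\gamma^1(y^1),\dots,\gamma^N(y^N))]\in[0,\infty]$. Suppose that the information structure is classical (nested), that is, $\sigma(y^n)\subset\sigma(y^{n+1})$ for $1\le n<N$, and that $\prod_k(\mathbb Y^k\times\mathbb U^k)$ is compact. Let $P(d\omega_0\mid\mathbf y)$ be a regular conditional distribution of $\omega_0$ given $\mathbf y=(y^1,\dots,y^N)$ (one exists if $\Omega_0$ is standard Borel), and suppose that, for every $\mathbf y\in\prod_k\mathbb Y^k$, the conditional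 cost $$\tilde c(\mathbf y,\mathbf u)=\int c(\omega_0,\mathbf u)\,P(d\omega_0\mid\mathbf y)\in[0,\infty]$$ is jointly lower semicontinuous in $\mathbf u=(u^1,\dots,u^N)$. Suppose further that, for every $1<n\le N$, there is a version of the stochastic kernel $P(dy^n\mid y^{n-1})$ such that $\int f(y^n)\,P(dy^n\mid y^{n-1})$ is continuous in $y^{n-1}$ for every bounded continuous $f:\mathbb Y^n\to\mathbb R$. Then there is an optimal team policy which is deterministic: there is a team policy $\underline\gamma^*$ with $J(\underline\gamma^*)=\inf_{\underline\gamma}J(\underline\gamma)$, the infimum being over all team policies, and moreover $J(\underline\gamma^*)$ does not exceed the expected cost of any individually randomized policy, under which the actions $u^k$ are drawn, conditionally independently given $\omega$, from stochastic kernels $\Pi^k(du^k\mid y^k)$. -/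

import Mathlib

open MeasureTheory ProbabilityTheory
open scoped NNReal ENNReal BoundedContinuousFunction

noncomputable section

/-- A static stochastic team with `N` decision makers. Nature draws `ω` from the probability
measure `P`; decision maker `k` observes `y^k = η^k(ω)`, which no action affects, and then chooses
an action `u^k` in `U k`. The nonnegative cost depends on the exogenous variable `ω₀` (a function
of `ω`) and on all the actions. -/
structure StaticTeam (N : ℕ) (Ω Ω₀ : Type*) (Y U : Fin N → Type*)
    [MeasurableSpace Ω] [MeasurableSpace Ω₀]
    [∀ k, MeasurableSpace (Y k)] [∀ k, MeasurableSpace (U k)] where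
  /-- the law of nature -/
  P : Measure Ω
  isProbabilityMeasure : IsProbabilityMeasure P
  /-- the cost-relevant exogenous variable -/
  ω₀ : Ω → Ω₀
  measurable_ω₀ : Measurable ω₀
  /-- the measurement maps -/
  η : ∀ k, Ω → Y k
  measurable_η : ∀ k, Measurable (η k)
  /-- the cost function -/
  c : Ω₀ → (∀ k, U k) → ℝ≥0
  measurable_c : Measurable (fun p : Ω₀ × (∀ k, U k) => c p.1 p.2)

namespace StaticTeam

variable {N : ℕ} {Ω Ω₀ : Type*} {Y U : Fin N → Type*}
  [MeasurableSpace Ω] [MeasurableSpace Ω₀]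
  [∀ k, MeasurableSpace (Y k)] [∀ k, MeasurableSpace (U k)]

/-- The tuple `𝐲 = (y^1, …, y^N)` of all measurements. -/
def obs (T : StaticTeam N Ω Ω₀ Y U) (ω : Ω) : ∀ k, Y k := fun k => T.η k ω

/-- Admissible (deterministic) team policies: tuples of measurable maps `γ^k : Y k → U k`. -/
def Policy (_T : StaticTeam N Ω Ω₀ Y U) : Type _ := ∀ k, {γ : Y k → U k // Measurable γ}

/-- The expected cost `J(γ) = E[c(ω₀, γ^1(y^1), …, γ^N(y^N))]`, a value in `[0, ∞]`. -/
def cost (T : StaticTeam N Ω Ω₀ Y U) (γ : T.Policy) : ℝ≥0∞ :=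
  ∫⁻ ω, (T.c (T.ω₀ ω) (fun k => (γ k).1 (T.η k ω)) : ℝ≥0∞) ∂T.P

/-- A team-optimal policy: it attains the infimum of the expected cost over all policies. -/
def IsTeamOptimal (T : StaticTeam N Ω Ω₀ Y U) (γ : T.Policy) : Prop :=
  T.cost γ = ⨅ γ' : T.Policy, T.cost γ'

/-- The expected cost under individually randomized policies: given the measurements, the actions
`u^k` are drawn independently of each other from `Q^k(du^k | y^k)`. -/
def randomizedCost (T : StaticTeam N Ω Ω₀ Y U) (Q : ∀ k, Kernel (Y k) (U k)) : ℝ≥0∞ :=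
  ∫⁻ ω, ∫⁻ u, (T.c (T.ω₀ ω) u : ℝ≥0∞) ∂(Measure.pi fun k => Q k (T.η k ω)) ∂T.P

/-- The information structure is classical (nested): `σ(y^n) ⊆ σ(y^{n+1})`. -/
def IsClassical (T : StaticTeam N Ω Ω₀ Y U) : Prop :=
  ∀ i j : Fin N, (i : ℕ) + 1 = j →
    MeasurableSpace.comap (T.η i) inferInstance ≤ MeasurableSpace.comap (T.η j) inferInstance

/-- The conditional cost `c̃(y, u) = ∫ c(ω₀, u) P(dω₀ | y)`, a value in `[0, ∞]`, where the kernel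
`κ` is the version of `P(dω₀ | y)` that is used. -/
def condCost (T : StaticTeam N Ω Ω₀ Y U) (κ : Kernel (∀ k, Y k) Ω₀)
    (y : ∀ k, Y k) (u : ∀ k, U k) : ℝ≥0∞ :=
  ∫⁻ w, (T.c w u : ℝ≥0∞) ∂(κ y)

/-- The conditional laws `P(dy^n | y^{n-1})`, `n > 1`, have weakly continuous versions: Markov
kernels for which `∫ f(y^n) P(dy^n | y^{n-1})` is continuous in `y^{n-1}` for every bounded
continuous `f`. -/
def HasWeaklyContinuousKernels [∀ k, TopologicalSpace (Y k)]
    (T : StaticTeam N Ω Ω₀ Y U) : Prop :=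
  ∀ i j : Fin N, (i : ℕ) + 1 = j →
    ∃ p : Kernel (Y i) (Y j), IsMarkovKernel p ∧ HasCondDistrib (T.η j) (T.η i) p T.P ∧
      ∀ f : Y j →ᵇ ℝ, Continuous fun z : Y i => ∫ x, f x ∂(p z)

end StaticTeam

end

/-! Take policies whose costs decrease to the infimum. For each `ω` their action vectors lie in a
compact space. A Komlós-type argument in `L²` (`exists_averageLaw_tendsto_ae`) gives weights on the
tails of the sequence, the same for all `ω`, such that the averaged Dirac masses at these vectors
converge weakly to a random law `M ω` for almost every `ω`. Since the conditional cost is lower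
semicontinuous, the portmanteau theorem and Fatou's lemma show that `M` costs no more than the
infimum. `M` may correlate the actions. But by nestedness the first `j` actions of each policy are a
function of `y^j`. As the weights do not depend on `ω`, the limit law of these actions also depends
on `y^j` only. This is what `exists_policy_lintegral_le` needs to derandomize `M`, from the last
action backwards: write `u^j` as a function of `y^j`, the earlier actions and uniform noise, and fix
a noise value that does not raise the cost. Once the earlier actions are deterministic, they are
recoverable from `y^j`, so the rule for `u^j` is admissible. Independent randomization cannot beat
the infimum (`iInf_cost_le_randomizedCost`): with the noise fixed, it is a deterministic policy. -/

/-! ### Convex combinations of tails, weak limits of kernels, portmanteau. -/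

section WeakCompactness

open Filter Topology

/-- In a Hilbert space, a decreasing sequence of nonempty bounded midpoint-convex sets admits a
norm-convergent sequence of representatives. -/
theorem exists_tendsto_mem_of_midpoint_mem {H : Type*} [NormedAddCommGroup H]
    [InnerProductSpace ℝ H] [CompleteSpace H] {C : ℕ → Set H} (hanti : Antitone C)
    (hne : ∀ n, (C n).Nonempty)
    (hmid : ∀ n, ∀ x ∈ C n, ∀ y ∈ C n, (2⁻¹ : ℝ) • (x + y) ∈ C n)
    {R : ℝ} (hR : ∀ n, ∀ x ∈ C n, ‖x‖ ≤ R) :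
    ∃ (y : ℕ → H) (z : H), (∀ n, y n ∈ C n) ∧ Tendsto y atTop (𝓝 z) := by
  let S : ℕ → Set ℝ := fun n => (fun x : H => ‖x‖ ^ 2) '' C n
  let d : ℕ → ℝ := fun n => sInf (S n)
  have hSne : ∀ n, (S n).Nonempty := fun n => (hne n).image _
  have hSbdd : ∀ n, BddBelow (S n) := fun n => ⟨0, by rintro _ ⟨x, -, rfl⟩; positivity⟩
  have hdle : ∀ n, ∀ x ∈ C n, d n ≤ ‖x‖ ^ 2 := fun n x hx =>
    csInf_le (hSbdd n) ⟨x, hx, rfl⟩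
  have hdmono : Monotone d := fun n m hnm =>
    csInf_le_csInf (hSbdd n) (hSne m) (Set.image_mono (hanti hnm))
  have hdR : BddAbove (Set.range d) := by
    refine ⟨R ^ 2, ?_⟩
    rintro _ ⟨n, rfl⟩
    obtain ⟨x, hx⟩ := hne n
    exact (hdle n x hx).trans (pow_le_pow_left₀ (norm_nonneg _) (hR n x hx) 2)
  have hlim := tendsto_atTop_ciSup hdmono hdR
  set D := ⨆ n, d n
  have hex : ∀ n : ℕ, ∃ y ∈ C n, ‖y‖ ^ 2 < d n + 1 / ((n : ℝ) + 1) := by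
    intro n
    obtain ⟨_, ⟨y, hy, rfl⟩, hlt⟩ := exists_lt_of_csInf_lt (hSne n)
      (show sInf (S n) < d n + 1 / ((n : ℝ) + 1) from lt_add_of_pos_right _ (by positivity))
    exact ⟨y, hy, hlt⟩
  choose y hyC hy using hex
  -- Near-minimizers of the norm are Cauchy: for `m ≥ n` the midpoint of `y n` and `y m` is in `C
  -- n`, so its squared norm is at least `d n`, and the parallelogram law bounds the distance.
  have hcauchy : CauchySeq y := by
    refine cauchySeq_of_le_tendsto_0'
      (fun n : ℕ => √(2 * (D - d n) + 4 * (1 / ((n : ℝ) + 1)))) ?_ ?_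
    · intro n m hnm
      rw [dist_eq_norm]
      refine Real.le_sqrt_of_sq_le ?_
      have hp := parallelogram_law_with_norm ℝ (y n) (y m)
      have h1 := hdle n _ (hmid n _ (hyC n) _ (hanti hnm (hyC m)))
      rw [norm_smul, mul_pow] at h1
      norm_num at h1
      have h2 := hy n
      have h3 := hy m
      have h4 : d m ≤ D := le_ciSup hdR m
      have h5 : 1 / ((m : ℝ) + 1) ≤ 1 / ((n : ℝ) + 1) := by
        apply one_div_le_one_div_of_le (by positivity)
        have : (n : ℝ) ≤ m := by exact_mod_cast hnm
        linarith
      nlinarith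
    · have h1 : Tendsto (fun n : ℕ => 2 * (D - d n) + 4 * (1 / ((n : ℝ) + 1))) atTop
          (𝓝 (2 * (D - D) + 4 * 0)) :=
        ((tendsto_const_nhds.sub hlim).const_mul 2).add
          (tendsto_one_div_add_atTop_nhds_zero_nat.const_mul 4)
      have h2 := (Real.continuous_sqrt.tendsto _).comp h1
      simpa [Function.comp_def] using h2
  obtain ⟨z, hz⟩ := cauchySeq_tendsto_of_complete hcauchy
  exact ⟨y, z, hyC, hz⟩

/-- A uniformly bounded sequence of measurable functions has convex combinations of its tails
which converge almost everywhere. -/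
theorem exists_weights_tendsto_ae {α : Type*} [MeasurableSpace α] (ν : Measure α)
    [IsFiniteMeasure ν] {X : ℕ → α → ℝ} (hX : ∀ n, Measurable (X n)) {R : ℝ}
    (hR : ∀ n a, |X n a| ≤ R) :
    ∃ w : ℕ → Measure ℕ, (∀ n, IsProbabilityMeasure (w n)) ∧ (∀ n, ∀ᵐ j ∂(w n), n ≤ j) ∧
      ∀ᵐ a ∂ν, ∃ l, Tendsto (fun n => ∫ j, X j a ∂(w n)) atTop (𝓝 l) := by
  have hint : ∀ (w : Measure ℕ) [IsFiniteMeasure w] (a : α), Integrable (fun j => X j a) w :=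
    fun w _ a => Integrable.of_bound (by fun_prop) R (ae_of_all _ fun j => hR j a)
  -- Weights are probability measures on `{j | n ≤ j}`, so that averages are integrals.
  let C : ℕ → Set (Lp ℝ 2 ν) := fun n => {h | ∃ w : Measure ℕ, IsProbabilityMeasure w ∧
    (∀ᵐ j ∂w, n ≤ j) ∧ h =ᵐ[ν] fun a => ∫ j, X j a ∂w}
  have hanti : Antitone C := by
    rintro n m hnm h ⟨w, hw, hs, he⟩
    exact ⟨w, hw, hs.mono fun j hj => hnm.trans hj, he⟩
  have hne : ∀ n, (C n).Nonempty := by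
    intro n
    have hm : MemLp (X n) 2 ν :=
      MemLp.of_bound (hX n).aestronglyMeasurable R (ae_of_all _ fun a => hR n a)
    refine ⟨hm.toLp, Measure.dirac n, inferInstance, ?_, ?_⟩
    · rw [ae_dirac_eq]; exact le_refl n
    · filter_upwards [hm.coeFn_toLp] with a ha
      rw [ha, integral_dirac]
  have hmid : ∀ n, ∀ x ∈ C n, ∀ y ∈ C n, (2⁻¹ : ℝ) • (x + y) ∈ C n := by
    rintro n x ⟨w, hw, hs, he⟩ y ⟨w', hw', hs', he'⟩
    refine ⟨(2⁻¹ : ℝ≥0) • (w + w'), ⟨?_⟩, ?_, ?_⟩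
    · rw [Measure.smul_apply, Measure.add_apply, measure_univ, measure_univ, one_add_one_eq_two,
        ENNReal.smul_def, smul_eq_mul, ENNReal.coe_inv two_ne_zero]
      exact ENNReal.inv_mul_cancel two_ne_zero ENNReal.ofNat_ne_top
    · refine Measure.ae_smul_measure ?_ _
      rw [ae_add_measure_iff]
      exact ⟨hs, hs'⟩
    · filter_upwards [Lp.coeFn_smul (2⁻¹ : ℝ) (x + y), Lp.coeFn_add x y, he, he']
        with a h1 h2 h3 h4
      rw [h1, Pi.smul_apply, h2, Pi.add_apply, h3, h4, integral_smul_nnreal_measure,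
        integral_add_measure (hint w a) (hint w' a)]
      rw [NNReal.smul_def, smul_eq_mul, smul_eq_mul, NNReal.coe_inv, NNReal.coe_ofNat]
  have hbdd : ∀ n, ∀ x ∈ C n, ‖x‖ ≤ measureUnivNNReal ν ^ ((2 : ℝ≥0∞).toReal)⁻¹ * |R| := by
    rintro n x ⟨w, hw, -, he⟩
    refine Lp.norm_le_of_ae_bound (abs_nonneg R) ?_
    filter_upwards [he] with a ha
    rw [ha]
    refine (norm_integral_le_of_norm_le_const (C := |R|) (ae_of_all _ fun j =>
      (hR j a).trans (le_abs_self R))).trans ?_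
    simp
  obtain ⟨y, z, hyC, hyz⟩ := exists_tendsto_mem_of_midpoint_mem hanti hne hmid hbdd
  -- A subsequence converges almost everywhere; as `n ≤ ns n`, its weights still live on the tails.
  obtain ⟨ns, hns, hae⟩ := (tendstoInMeasure_of_tendsto_Lp hyz).exists_seq_tendsto_ae
  choose w hw hs he using hyC
  refine ⟨fun n => w (ns n), fun n => hw _, fun n => (hs (ns n)).mono fun j hj =>
    (hns.id_le n).trans hj, ?_⟩
  filter_upwards [hae, ae_all_iff.2 he] with a ha hea
  refine ⟨z a, ha.congr fun n => hea _⟩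

/-- The version of `exists_weights_tendsto_ae` for countably many sequences simultaneously. -/
theorem exists_weights_forall_tendsto_ae {α : Type*} [MeasurableSpace α] (ν : Measure α)
    [IsFiniteMeasure ν] {X : ℕ → ℕ → α → ℝ} (hX : ∀ n i, Measurable (X n i)) {R : ℕ → ℝ}
    (hR : ∀ n i a, |X n i a| ≤ R i) :
    ∃ w : ℕ → Measure ℕ, (∀ n, IsProbabilityMeasure (w n)) ∧ (∀ n, ∀ᵐ j ∂(w n), n ≤ j) ∧
      ∀ᵐ a ∂ν, ∀ i, ∃ l, Tendsto (fun n => ∫ j, X j i a ∂(w n)) atTop (𝓝 l) := by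
  -- All sequences become one on `α × ℕ`, rescaled to a common bound; `τ` is finite with only the
  -- empty set null, so an almost everywhere statement holds for every index `i`.
  let τ : Measure ℕ := (Measure.count : Measure ℕ).toFinite
  have hpos : ∀ i, 0 < 1 + |R i| := fun i => by positivity
  obtain ⟨w, hw, hs, hae⟩ := exists_weights_tendsto_ae (ν.prod τ)
    (X := fun n p => (1 + |R p.2|)⁻¹ * X n p.2 p.1) (R := 1)
    (fun n => measurable_from_prod_countable_left fun i =>
      (hX n i).const_mul (1 + |R i|)⁻¹)
    (fun n p => by
      rw [abs_mul, abs_inv, abs_of_pos (hpos _), inv_mul_le_iff₀ (hpos _), mul_one]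
      exact (hR n p.2 p.1).trans ((le_abs_self _).trans (by linarith)))
  refine ⟨w, hw, hs, ?_⟩
  filter_upwards [Measure.ae_ae_of_ae_prod hae] with a ha i
  obtain ⟨l, hl⟩ : ∃ l, Tendsto (fun n => ∫ j, (1 + |R i|)⁻¹ * X j i a ∂(w n)) atTop (𝓝 l) := by
    rw [ae_toFinite, Measure.ae_count_iff] at ha
    exact ha i
  refine ⟨(1 + |R i|) * l, (hl.const_mul (1 + |R i|)).congr fun n => ?_⟩
  rw [integral_const_mul, mul_inv_cancel_left₀ (hpos i).ne']

variable {K : Type*} [TopologicalSpace K] [CompactSpace K] [PolishSpace K] [MeasurableSpace K]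
  [BorelSpace K]

/-- Probability measures on a compact metrizable space converge weakly as soon as their integrals
against a dense sequence of continuous functions converge. -/
theorem exists_tendsto_of_forall_integral_tendsto {μ : ℕ → ProbabilityMeasure K}
    {f : ℕ → C(K, ℝ)} (hf : DenseRange f)
    (h : ∀ i, ∃ l, Tendsto (fun n => ∫ x, f i x ∂(μ n : Measure K)) atTop (𝓝 l)) :
    ∃ ν : ProbabilityMeasure K, Tendsto μ atTop (𝓝 ν) := by
  choose l hl using h
  have hval : ∀ ν : ProbabilityMeasure K, MapClusterPt ν atTop μ → ∀ i,
      ∫ x, f i x ∂(ν : Measure K) = l i := by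
    intro ν hν i
    have hc : Continuous fun ν : ProbabilityMeasure K => ∫ x, f i x ∂(ν : Measure K) :=
      ProbabilityMeasure.continuous_integral_boundedContinuousFunction
        (BoundedContinuousFunction.mkOfCompact (f i))
    have h1 : MapClusterPt (∫ x, f i x ∂(ν : Measure K)) atTop
        (fun n => ∫ x, f i x ∂(μ n : Measure K)) := hν.continuousAt_comp hc.continuousAt
    have h2 := h1.clusterPt.mono (hl i)
    exact eq_of_nhds_neBot h2
  -- Compactness gives a cluster point. It is unique, since integrals against the dense family
  -- determine a measure.
  obtain ⟨ν, hν⟩ := exists_clusterPt_of_compactSpace (map μ atTop)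
  refine ⟨ν, tendsto_nhds_of_unique_mapClusterPt fun ν' hν' => ?_⟩
  apply Subtype.ext
  change (ν' : Measure K) = (ν : Measure K)
  refine ext_of_forall_integral_eq_of_IsFiniteMeasure fun g => ?_
  have hcont : ∀ ρ : ProbabilityMeasure K,
      Continuous fun g : C(K, ℝ) => ∫ x, g x ∂(ρ : Measure K) := fun ρ => by
    refine (LipschitzWith.of_dist_le_mul (K := 1) fun g g' => ?_).continuous
    have hi : ∀ g : C(K, ℝ), Integrable g (ρ : Measure K) := fun g =>
      (BoundedContinuousFunction.mkOfCompact g).integrable _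
    rw [dist_eq_norm, ← integral_sub (hi g) (hi g'), dist_eq_norm, NNReal.coe_one, one_mul]
    refine (norm_integral_le_of_norm_le_const (C := ‖g - g'‖) (ae_of_all _ fun x =>
      (g - g').norm_coe_le_norm x)).trans ?_
    simp
  have hall : ∀ g : C(K, ℝ), ∫ x, g x ∂(ν' : Measure K) = ∫ x, g x ∂(ν : Measure K) :=
    fun g => congrFun (hf.equalizer (hcont ν') (hcont ν)
      (funext fun i => (hval ν' hν' i).trans (hval ν hν i).symm)) g
  exact hall g.toContinuousMap

/-- The value of a Markov kernel at a point, as a bundled probability measure. -/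
def kernelProb {Z X : Type*} [MeasurableSpace Z] [MeasurableSpace X] (A : Kernel Z X)
    [IsMarkovKernel A] (z : Z) : ProbabilityMeasure X := ⟨A z, inferInstance⟩

/-- Pointwise weak limits of Markov kernels into a compact metrizable space form, where they
exist, a Markov kernel. -/
theorem exists_kernel_eq_of_tendsto [Nonempty K] {Z : Type*} [MeasurableSpace Z]
    (A : ℕ → Kernel Z K) [∀ n, IsMarkovKernel (A n)] :
    ∃ B : Kernel Z K, IsMarkovKernel B ∧ ∀ z (μ : ProbabilityMeasure K),
      Tendsto (fun n => kernelProb (A n) z) atTop (𝓝 μ) →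
        B z = μ := by
  classical
  let a : ℕ → Z → ProbabilityMeasure K := fun n z => kernelProb (A n) z
  let S : Set Z := {z | ∃ μ, Tendsto (fun n => a n z) atTop (𝓝 μ)}
  obtain ⟨f, hf⟩ := TopologicalSpace.exists_dense_seq C(K, ℝ)
  have hS : MeasurableSet S := by
    have : S = ⋂ i, {z | ∃ l, Tendsto (fun n => ∫ x, f i x ∂(A n z)) atTop (𝓝 l)} := by
      ext z
      simp only [S, Set.mem_ofPred_eq, Set.mem_iInter]
      refine ⟨fun ⟨μ, hμ⟩ i => ⟨_, ProbabilityMeasure.tendsto_iff_forall_integral_tendsto.1 hμ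
        (BoundedContinuousFunction.mkOfCompact (f i))⟩, fun h =>
        exists_tendsto_of_forall_integral_tendsto hf h⟩
    rw [this]
    refine MeasurableSet.iInter fun i => measurableSet_exists_tendsto fun n => ?_
    exact (StronglyMeasurable.integral_kernel (f i).continuous.stronglyMeasurable).measurable
  -- Off the measurable convergence set `S`, the kernel takes an arbitrary constant value.
  let k₀ : K := Classical.arbitrary K
  let δ₀ : ProbabilityMeasure K := ⟨Measure.dirac k₀, inferInstance⟩
  let b : Z → ProbabilityMeasure K := fun z => if h : z ∈ S then h.choose else δ₀
  have hb : ∀ z, Tendsto (fun n => if z ∈ S then a n z else δ₀) atTop (𝓝 (b z)) := by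
    intro z
    by_cases h : z ∈ S
    · simp only [if_pos h, b, dif_pos h]
      exact h.choose_spec
    · simp only [if_neg h, b, dif_neg h]
      exact tendsto_const_nhds
  have hmeas : ∀ g : K →ᵇ ℝ≥0, Measurable fun z => ∫⁻ x, g x ∂(b z : Measure K) := by
    intro g
    refine measurable_of_tendsto_metrizable (f := fun n z => if z ∈ S then ∫⁻ x, g x ∂(A n z) else
      ∫⁻ x, g x ∂(δ₀ : Measure K)) (fun n => ?_) ?_
    · refine Measurable.ite hS (Measurable.lintegral_kernel ?_) measurable_const
      exact measurable_coe_nnreal_ennreal.comp g.continuous.measurable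
    · rw [tendsto_pi_nhds]
      intro z
      refine (ProbabilityMeasure.tendsto_iff_forall_lintegral_tendsto.1 (hb z) g).congr fun n => ?_
      by_cases h : z ∈ S
      · simp only [if_pos h]; rfl
      · simp only [if_neg h]
  have hbm : Measurable fun z => (b z : Measure K) := by
    refine Measurable.measure_of_isPiSystem_of_isProbabilityMeasure
      ((BorelSpace.measurable_eq (α := K)).trans borel_eq_generateFrom_isClosed)
      isPiSystem_isClosed fun F hF => ?_
    refine measurable_of_tendsto_metrizable (fun n => hmeas (hF.apprSeq n)) ?_
    rw [tendsto_pi_nhds]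
    exact fun z => HasOuterApproxClosed.tendsto_lintegral_apprSeq hF _
  refine ⟨⟨fun z => b z, hbm⟩, ⟨fun z => (b z).2⟩, fun z μ hμ => ?_⟩
  have hz : z ∈ S := ⟨μ, hμ⟩
  have h1 := hb z
  simp only [if_pos hz] at h1
  exact congrArg (fun ρ : ProbabilityMeasure K => (ρ : Measure K)) (tendsto_nhds_unique h1 hμ)

/-- The portmanteau theorem for lower semicontinuous functions with values in `[0, ∞]`. -/
theorem lintegral_le_liminf_of_lowerSemicontinuous {X : Type*} [TopologicalSpace X]
    [MeasurableSpace X] [BorelSpace X] [HasOuterApproxClosed X] {μ : ℕ → ProbabilityMeasure X}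
    {ν : ProbabilityMeasure X} (hμ : Tendsto μ atTop (𝓝 ν)) {f : X → ℝ≥0∞}
    (hf : LowerSemicontinuous f) :
    ∫⁻ x, f x ∂(ν : Measure X) ≤ liminf (fun n => ∫⁻ x, f x ∂(μ n : Measure X)) atTop := by
  have hfm : Measurable f := hf.measurable
  have htrunc : ∀ m : ℕ, ∫⁻ x, min (f x) m ∂(ν : Measure X) ≤
      liminf (fun n => ∫⁻ x, f x ∂(μ n : Measure X)) atTop := by
    -- The layer-cake formula reduces the truncated integral to measures of superlevel sets, which
    -- are open: those of `f` below height `m`, empty above.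
    intro m
    let g : X → ℝ := fun x => (min (f x) m).toReal
    have hfin : ∀ x, min (f x) (m : ℝ≥0∞) ≠ ∞ := fun x =>
      ((min_le_right _ _).trans_lt (ENNReal.natCast_lt_top m)).ne
    have hg : ∀ x, min (f x) (m : ℝ≥0∞) = ENNReal.ofReal (g x) := fun x =>
      (ENNReal.ofReal_toReal (hfin x)).symm
    have hgm : Measurable g := (hfm.min measurable_const).ennreal_toReal
    have hopen : ∀ t ∈ Set.Ioi (0 : ℝ), IsOpen {x | t < g x} := by
      intro t ht
      by_cases htm : t < m
      · have : {x | t < g x} = f ⁻¹' Set.Ioi (ENNReal.ofReal t) := by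
          ext x
          simp only [Set.mem_ofPred_eq, Set.mem_preimage, Set.mem_Ioi, g]
          rw [← ENNReal.ofReal_lt_iff_lt_toReal (le_of_lt ht) (hfin x), lt_min_iff,
            and_iff_left]
          rw [← ENNReal.ofReal_natCast]
          exact (ENNReal.ofReal_lt_ofReal_iff (lt_trans ht htm)).2 htm
        rw [this]
        exact hf.isOpen_preimage _
      · have : {x | t < g x} = ∅ := by
          ext x
          simp only [Set.mem_ofPred_eq, Set.mem_empty_iff_false, iff_false, not_lt]
          refine le_trans ?_ (not_lt.1 htm)
          exact ENNReal.toReal_le_of_le_ofReal (Nat.cast_nonneg m) (by simp)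
        rw [this]
        exact isOpen_empty
    have hlayer : ∀ ρ : Measure X, ∫⁻ x, min (f x) (m : ℝ≥0∞) ∂ρ =
        ∫⁻ t in Set.Ioi (0 : ℝ), ρ {x | t < g x} := by
      intro ρ
      simp_rw [hg]
      exact lintegral_eq_lintegral_meas_lt ρ (ae_of_all _ fun x => ENNReal.toReal_nonneg)
        hgm.aemeasurable
    calc ∫⁻ x, min (f x) m ∂(ν : Measure X)
        = ∫⁻ t in Set.Ioi (0 : ℝ), (ν : Measure X) {x | t < g x} := hlayer _
      _ ≤ ∫⁻ t in Set.Ioi (0 : ℝ), liminf (fun n => (μ n : Measure X) {x | t < g x}) atTop :=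
          setLIntegral_mono' measurableSet_Ioi fun t ht =>
            ProbabilityMeasure.le_liminf_measure_open_of_tendsto hμ (hopen t ht)
      _ ≤ liminf (fun n => ∫⁻ t in Set.Ioi (0 : ℝ), (μ n : Measure X) {x | t < g x}) atTop :=
          lintegral_liminf_le fun n => Antitone.measurable fun s t hst =>
            measure_mono fun x hx => lt_of_le_of_lt hst hx
      _ ≤ liminf (fun n => ∫⁻ x, f x ∂(μ n : Measure X)) atTop := by
          refine liminf_le_liminf (Eventually.of_forall fun n => ?_)
          rw [← hlayer]
          exact lintegral_mono fun x => min_le_left _ _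
  have hsup : ∀ x, f x = ⨆ m : ℕ, min (f x) m := by
    intro x
    rw [← inf_iSup_eq, ENNReal.iSup_natCast, inf_top_eq]
  calc ∫⁻ x, f x ∂(ν : Measure X) = ∫⁻ x, ⨆ m : ℕ, min (f x) m ∂(ν : Measure X) :=
        lintegral_congr hsup
    _ = ⨆ m : ℕ, ∫⁻ x, min (f x) m ∂(ν : Measure X) :=
        lintegral_iSup (fun m => hfm.min measurable_const) fun m m' h x =>
          min_le_min_left _ (by exact_mod_cast h)
    _ ≤ _ := iSup_le htrunc

end WeakCompactness

/-! ### Random averages of Dirac masses. -/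

section Averages

open Filter Topology

/-- The law of `x j` when the index `j` is drawn from `w`. -/
noncomputable def averageLaw {X : Type*} [MeasurableSpace X] (w : ProbabilityMeasure ℕ) (x : ℕ → X) :
    ProbabilityMeasure X := w.map (f := x) Measurable.of_discrete.aemeasurable

theorem lintegral_averageLaw {X : Type*} [MeasurableSpace X] (w : ProbabilityMeasure ℕ)
    (x : ℕ → X) {f : X → ℝ≥0∞} (hf : Measurable f) :
    ∫⁻ a, f a ∂(averageLaw w x : Measure X) = ∫⁻ j, f (x j) ∂(w : Measure ℕ) := by
  rw [averageLaw, ProbabilityMeasure.toMeasure_map, lintegral_map hf Measurable.of_discrete]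

theorem map_averageLaw {X X' : Type*} [MeasurableSpace X] [MeasurableSpace X']
    (w : ProbabilityMeasure ℕ) (x : ℕ → X) {f : X → X'} (hf : Measurable f) :
    (averageLaw w x).map hf.aemeasurable = averageLaw w fun j => f (x j) := by
  apply Subtype.ext
  exact Measure.map_map hf Measurable.of_discrete

variable {Z X : Type*} [MeasurableSpace Z] [MeasurableSpace X]

theorem exists_kernel_eq_averageLaw (w : ProbabilityMeasure ℕ) {x : ℕ → Z → X}
    (hx : ∀ j, Measurable (x j)) :
    ∃ (A : Kernel Z X) (_ : IsMarkovKernel A),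
      ∀ z, kernelProb A z = averageLaw w fun j => x j z := by
  have hm : Measurable fun p : Z × ℕ => x p.2 p.1 := measurable_from_prod_countable_left hx
  have hA : ∀ z, ((Kernel.id ×ₖ Kernel.const Z (w : Measure ℕ)).map fun p => x p.2 p.1) z =
      (averageLaw w fun j => x j z : Measure X) := by
    intro z
    rw [Kernel.map_apply _ hm, Kernel.prod_apply, Kernel.id_apply, Kernel.const_apply,
      Measure.dirac_prod, Measure.map_map hm (by fun_prop)]
    rfl
  exact ⟨_, Kernel.IsMarkovKernel.map _ hm, fun z => Subtype.ext (hA z)⟩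

variable {K : Type*} [TopologicalSpace K] [CompactSpace K] [PolishSpace K] [MeasurableSpace K]
  [BorelSpace K]

/-- Used with the same weights on `Ω` and on each `Y j`, so that the limits can be compared. -/
theorem exists_kernel_eq_lim_averageLaw [Nonempty K] (w : ℕ → ProbabilityMeasure ℕ)
    {x : ℕ → Z → K} (hx : ∀ j, Measurable (x j)) :
    ∃ B : Kernel Z K, IsMarkovKernel B ∧ ∀ z (μ : ProbabilityMeasure K),
      Tendsto (fun n => averageLaw (w n) fun j => x j z) atTop (𝓝 μ) → B z = μ := by
  choose A hA hAx using fun n => exists_kernel_eq_averageLaw (w n) hx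
  obtain ⟨B, hB, h⟩ := exists_kernel_eq_of_tendsto A
  exact ⟨B, hB, fun z μ hμ => h z μ (by simpa only [hAx] using hμ)⟩

/-- Any sequence of random variables in a compact metrizable space has averages of its tails
which, as random probability measures, converge weakly almost surely. -/
theorem exists_averageLaw_tendsto_ae (P : Measure Z) [IsFiniteMeasure P] {x : ℕ → Z → K}
    (hx : ∀ j, Measurable (x j)) :
    ∃ w : ℕ → ProbabilityMeasure ℕ, (∀ n, ∀ᵐ j ∂(w n : Measure ℕ), n ≤ j) ∧
      ∀ᵐ z ∂P, ∃ μ, Tendsto (fun n => averageLaw (w n) fun j => x j z) atTop (𝓝 μ) := by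
  rcases isEmpty_or_nonempty K with hK | hK
  · refine ⟨fun n => ⟨Measure.dirac n, inferInstance⟩, fun n => ?_, ae_of_all _ fun z =>
      (hK.false (x 0 z)).elim⟩
    change ∀ᵐ j ∂Measure.dirac n, n ≤ j
    rw [ae_dirac_eq]
    exact le_refl n
  obtain ⟨f, hf⟩ := TopologicalSpace.exists_dense_seq C(K, ℝ)
  obtain ⟨w, hw, hs, hae⟩ := exists_weights_forall_tendsto_ae P (X := fun n i z => f i (x n z))
    (R := fun i => ‖f i‖) (fun n i => (f i).continuous.measurable.comp (hx n))
    (fun n i z => (f i).norm_coe_le_norm _)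
  refine ⟨fun n => ⟨w n, hw n⟩, hs, ?_⟩
  filter_upwards [hae] with z hz
  refine exists_tendsto_of_forall_integral_tendsto hf fun i => ?_
  obtain ⟨l, hl⟩ := hz i
  refine ⟨l, hl.congr fun n => ?_⟩
  exact (integral_map Measurable.of_discrete.aemeasurable
    (f i).continuous.aestronglyMeasurable).symm

end Averages

/-! ### Initial segments of the actions, padded so as to stay in one type. -/

section Truncation

variable {N : ℕ} {U : Fin N → Type*}

/-- The tuple `u` with its entries from index `k` on replaced by those of `u₀`. -/
def truncate (u₀ : ∀ i, U i) (k : ℕ) (u : ∀ i, U i) : ∀ i, U i :=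
  fun i => if (i : ℕ) < k then u i else u₀ i

theorem truncate_self (u₀ u : ∀ i, U i) : truncate u₀ N u = u :=
  funext fun i => if_pos i.2

theorem truncate_zero (u₀ u : ∀ i, U i) : truncate u₀ 0 u = u₀ :=
  funext fun i => if_neg (Nat.not_lt_zero i)

theorem truncate_truncate (u₀ u : ∀ i, U i) {k l : ℕ} (h : k ≤ l) :
    truncate u₀ k (truncate u₀ l u) = truncate u₀ k u := by
  funext i
  simp only [truncate]
  split_ifs <;> first | rfl | omega

theorem truncate_congr {u₀ u v : ∀ i, U i} {k : ℕ} (h : ∀ i : Fin N, (i : ℕ) < k → u i = v i) :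
    truncate u₀ k u = truncate u₀ k v := by
  funext i
  simp only [truncate]
  split_ifs with hi
  exacts [h i hi, rfl]

theorem truncate_succ (u₀ u : ∀ i, U i) (j : Fin N) :
    truncate u₀ (j + 1) u = Function.update (truncate u₀ j u) j (u j) := by
  funext i
  rcases eq_or_ne i j with rfl | h
  · simp [truncate]
  · have h' : (i : ℕ) ≠ j := fun e => h (Fin.ext e)
    simp only [Function.update_of_ne h, truncate]
    split_ifs <;> first | rfl | omega

theorem measurable_truncate [∀ i, MeasurableSpace (U i)] (u₀ : ∀ i, U i) (k : ℕ) :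
    Measurable (truncate u₀ k) := by
  refine measurable_pi_lambda _ fun i => ?_
  simp only [truncate]
  split_ifs
  exacts [measurable_pi_apply i, measurable_const]

theorem continuous_truncate [∀ i, TopologicalSpace (U i)] (u₀ : ∀ i, U i) (k : ℕ) :
    Continuous (truncate u₀ k) := by
  refine continuous_pi fun i => ?_
  simp only [truncate]
  split_ifs
  exacts [continuous_apply i, continuous_const]

end Truncation

/-! ### Derandomization by backward elimination of the actions. -/

section Derandomization

variable {N : ℕ} {Ω : Type*} {Y U : Fin N → Type*} [∀ k, MeasurableSpace (Y k)]
  [∀ k, MeasurableSpace (U k)]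
  [∀ k, StandardBorelSpace (U k)] [∀ k, Nonempty (U k)]

/-- Under nested information, the first actions of a policy are a function of any later
measurement. -/
theorem exists_truncate_eq_comp {η : ∀ k, Ω → Y k}
    (hη : ∀ i j : Fin N, i ≤ j → MeasurableSpace.comap (η i) inferInstance ≤
      MeasurableSpace.comap (η j) inferInstance)
    (u₀ : ∀ i, U i) {γ : ∀ i, Y i → U i} (hγ : ∀ i, Measurable (γ i)) (j : Fin N) {k : ℕ}
    (hk : k ≤ j + 1) :
    ∃ F : Y j → ∀ i, U i, Measurable F ∧
      ∀ ω, truncate u₀ k (fun i => γ i (η i ω)) = F (η j ω) := by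
  have hm : Measurable[MeasurableSpace.comap (η j) inferInstance]
      fun ω => truncate u₀ k fun i => γ i (η i ω) := by
    refine @measurable_pi_lambda _ _ _ (MeasurableSpace.comap (η j) inferInstance) _ _ fun i => ?_
    simp only [truncate]
    split_ifs with hi
    · exact ((hγ i).comp (comap_measurable (η i))).mono (hη i j (by
        rw [Fin.le_def]; omega)) le_rfl
    · exact measurable_const
  obtain ⟨F, hF, h⟩ := hm.exists_eq_measurable_comp
  exact ⟨F, hF, fun ω => congrFun h ω⟩

/-- Under nested information, a random choice `M` of all actions such that the conditional law of
the first actions `u^1, …, u^k` depends on the `k`-th measurement only can be replaced by a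
deterministic policy of no larger cost. -/
theorem exists_policy_lintegral_le [MeasurableSpace Ω] (P : Measure Ω) [IsProbabilityMeasure P] {η : ∀ k, Ω → Y k}
    (hηm : ∀ k, Measurable (η k))
    (hη : ∀ i j : Fin N, i ≤ j → MeasurableSpace.comap (η i) inferInstance ≤
      MeasurableSpace.comap (η j) inferInstance)
    (u₀ : ∀ i, U i) (M : Kernel Ω (∀ i, U i)) [IsMarkovKernel M]
    (A : ∀ j, Kernel (Y j) (∀ i, U i)) [∀ j, IsMarkovKernel (A j)]
    (hA : ∀ j : Fin N, ∀ᵐ ω ∂P, (M ω).map (truncate u₀ (j + 1)) = A j (η j ω))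
    {V : Ω → (∀ i, U i) → ℝ≥0∞} (hV : Measurable (Function.uncurry V)) :
    ∃ γ : ∀ i, Y i → U i, (∀ i, Measurable (γ i)) ∧
      ∫⁻ ω, V ω (fun i => γ i (η i ω)) ∂P ≤ ∫⁻ ω, ∫⁻ u, V ω u ∂(M ω) ∂P := by
  -- The induction is on the number of actions that `V` depends on; `V` varies because each step
  -- absorbs the last of them into it.
  suffices H : ∀ k ≤ N, ∀ V : Ω → (∀ i, U i) → ℝ≥0∞, Measurable (Function.uncurry V) →
      (∀ ω u, V ω (truncate u₀ k u) = V ω u) →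
      ∃ γ : ∀ i, Y i → U i, (∀ i, Measurable (γ i)) ∧
        ∫⁻ ω, V ω (fun i => γ i (η i ω)) ∂P ≤ ∫⁻ ω, ∫⁻ u, V ω u ∂(M ω) ∂P from
    H N le_rfl V hV fun ω u => by rw [truncate_self]
  intro k
  induction k with
  | zero =>
    intro _ V hV hVk
    refine ⟨fun i _ => u₀ i, fun i => measurable_const, lintegral_mono fun ω => ?_⟩
    have : ∀ u, V ω u = V ω u₀ := fun u => by rw [← hVk ω u, truncate_zero]
    simp only [this, lintegral_const, measure_univ, mul_one, le_refl]
  | succ k ih =>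
    intro hk V hV hVk
    let j : Fin N := ⟨k, hk⟩
    have hsucc : ∀ u, truncate u₀ (k + 1) u = Function.update (truncate u₀ k u) j (u j) :=
      fun u => truncate_succ u₀ u j
    let e : (∀ i, U i) → (∀ i, U i) × U j := fun u => (truncate u₀ k u, u j)
    have he : Measurable e := (measurable_truncate u₀ k).prodMk (measurable_pi_apply j)
    let A' : Kernel (Y j) ((∀ i, U i) × U j) := (A j).map e
    have hA' : IsMarkovKernel A' := Kernel.IsMarkovKernel.map _ he
    -- The conditional law of `u^j` given `y^j` and the earlier actions, realized by uniform noise.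
    obtain ⟨r, hr, hrq⟩ := A'.condKernel.exists_measurable_map_eq_unitInterval
    have hup : Measurable fun p : (∀ i, U i) × U j => Function.update p.1 j p.2 := by
      refine measurable_pi_lambda _ fun i => ?_
      rcases eq_or_ne i j with rfl | h
      · simpa using measurable_snd
      · simp only [Function.update_of_ne h]
        exact (measurable_pi_apply i).comp measurable_fst
    let V' : unitInterval → Ω → (∀ i, U i) → ℝ≥0∞ := fun ξ ω u =>
      V ω (Function.update (truncate u₀ k u) j (r (η j ω, truncate u₀ k u) ξ))
    have hV' : Measurable fun p : unitInterval × Ω × (∀ i, U i) => V' p.1 p.2.1 p.2.2 := by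
      have h1 : Measurable fun p : unitInterval × Ω × (∀ i, U i) => truncate u₀ k p.2.2 :=
        (measurable_truncate u₀ k).comp (by fun_prop)
      have h2 : Measurable fun p : unitInterval × Ω × (∀ i, U i) =>
          r (η j p.2.1, truncate u₀ k p.2.2) p.1 :=
        hr.comp ((((hηm j).comp (by fun_prop)).prodMk h1).prodMk measurable_fst)
      exact hV.comp ((by fun_prop : Measurable fun p : unitInterval × Ω × (∀ i, U i) =>
        p.2.1).prodMk (hup.comp (h1.prodMk h2)))
    have hlaw : ∀ᵐ ω ∂P, ∫⁻ u, V ω u ∂(M ω) = ∫⁻ ξ, ∫⁻ u, V' ξ ω u ∂(M ω) := by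
      filter_upwards [hA j] with ω hω
      have hVω : Measurable (V ω) := hV.comp measurable_prodMk_left
      have hVup : Measurable fun p : (∀ i, U i) × U j => V ω (Function.update p.1 j p.2) :=
        hVω.comp hup
      have hfst : A'.fst (η j ω) = (M ω).map (truncate u₀ k) := by
        rw [Kernel.fst_apply, Kernel.map_apply _ he, Measure.map_map measurable_fst he, ← hω,
          Measure.map_map (measurable_fst.comp he) (measurable_truncate u₀ _)]
        congr 1
        funext u
        exact truncate_truncate u₀ u (Nat.le_succ k)
      calc ∫⁻ u, V ω u ∂(M ω)
          = ∫⁻ u, V ω u ∂((M ω).map (truncate u₀ (k + 1))) := by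
            rw [lintegral_map hVω (measurable_truncate u₀ _)]
            exact lintegral_congr fun u => (hVk ω u).symm
        _ = ∫⁻ p, V ω (Function.update p.1 j p.2) ∂(A' (η j ω)) := by
            rw [show (M ω).map (truncate u₀ (k + 1)) = A j (η j ω) from hω,
              Kernel.map_apply _ he, lintegral_map hVup he]
            exact lintegral_congr fun u => by rw [← hVk ω u, hsucc]
        _ = ∫⁻ v, ∫⁻ x, V ω (Function.update v j x) ∂(A'.condKernel (η j ω, v))
              ∂(A'.fst (η j ω)) := by
            conv_lhs => rw [← A'.disintegrate A'.condKernel]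
            rw [Kernel.lintegral_compProd _ _ _ hVup]
        _ = ∫⁻ u, (∫⁻ ξ, V' ξ ω u) ∂(M ω) := by
            have h1 : ∀ v, ∫⁻ x, V ω (Function.update v j x) ∂(A'.condKernel (η j ω, v)) =
                ∫⁻ ξ, V ω (Function.update v j (r (η j ω, v) ξ)) := by
              intro v
              have hrv : Measurable (r (η j ω, v)) := hr.of_uncurry_left
              have hVv : Measurable fun x => V ω (Function.update v j x) :=
                hVup.comp measurable_prodMk_left
              rw [← hrq, lintegral_map hVv hrv]
            simp only [h1]
            rw [hfst, lintegral_map _ (measurable_truncate u₀ k)]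
            refine Measurable.lintegral_prod_right' (f := fun p : (∀ i, U i) × unitInterval =>
              V ω (Function.update p.1 j (r (η j ω, p.1) p.2))) ?_
            exact hVω.comp (hup.comp (measurable_fst.prodMk
              (hr.comp ((measurable_const.prodMk measurable_fst).prodMk measurable_snd))))
        _ = ∫⁻ ξ, ∫⁻ u, V' ξ ω u ∂(M ω) := by
            refine lintegral_lintegral_swap (Measurable.aemeasurable ?_)
            exact hV'.comp (measurable_snd.prodMk (measurable_const.prodMk measurable_fst))
    have hinner : Measurable fun p : unitInterval × Ω => ∫⁻ u, V' p.1 p.2 u ∂(M p.2) := by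
      refine Measurable.lintegral_kernel_prod_right (κ := M.comap Prod.snd measurable_snd)
        (f := fun (p : unitInterval × Ω) u => V' p.1 p.2 u) ?_
      exact hV'.comp (by fun_prop : Measurable fun p : (unitInterval × Ω) × (∀ i, U i) =>
        (p.1.1, p.1.2, p.2))
    have htotal : ∫⁻ ω, ∫⁻ u, V ω u ∂(M ω) ∂P = ∫⁻ ξ, ∫⁻ ω, ∫⁻ u, V' ξ ω u ∂(M ω) ∂P := by
      rw [lintegral_congr_ae hlaw]
      exact lintegral_lintegral_swap (hinner.comp measurable_swap).aemeasurable
    -- The noise value is chosen after integrating over `ω`, so it is one constant.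
    obtain ⟨ξ, hξ⟩ := exists_le_lintegral (μ := (volume : Measure unitInterval))
      (hinner.lintegral_prod_right' (ν := P)).aemeasurable
    obtain ⟨γ, hγ, hγV⟩ := ih (Nat.le_of_succ_le hk) (V' ξ)
      (hV'.comp (by fun_prop : Measurable fun p : Ω × (∀ i, U i) => (ξ, p.1, p.2)))
      (fun ω u => by simp only [V', truncate_truncate u₀ u le_rfl])
    -- Nestedness: the earlier actions, which `r` takes as input, are a function of `y^j`.
    obtain ⟨F, hF, hFγ⟩ := exists_truncate_eq_comp hη u₀ hγ j (Nat.le_succ k)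
    refine ⟨Function.update γ j fun y => r (y, F y) ξ, fun i => ?_, ?_⟩
    · rcases eq_or_ne i j with rfl | h
      · rw [Function.update_self]
        exact hr.comp ((measurable_id.prodMk hF).prodMk measurable_const)
      · rw [Function.update_of_ne h]
        exact hγ i
    · refine le_trans (le_of_eq (lintegral_congr fun ω => ?_)) (hγV.trans (hξ.trans htotal.ge))
      rw [← hVk, hsucc, Function.update_self]
      simp only [V', ← hFγ]
      congr 2
      refine truncate_congr fun i hi => ?_
      rw [Function.update_of_ne]
      rintro rfl
      exact lt_irrefl _ hi

end Derandomization

/-! ### Application to teams. -/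

namespace StaticTeam

open Filter Topology

variable {N : ℕ} {Ω Ω₀ : Type*} {Y U : Fin N → Type*}
  [MeasurableSpace Ω] [MeasurableSpace Ω₀]
  [∀ k, MeasurableSpace (Y k)] [∀ k, MeasurableSpace (U k)]

theorem IsClassical.comap_le {T : StaticTeam N Ω Ω₀ Y U} (hT : T.IsClassical) {i j : Fin N}
    (hij : i ≤ j) :
    MeasurableSpace.comap (T.η i) inferInstance ≤ MeasurableSpace.comap (T.η j) inferInstance := by
  obtain ⟨j, hj⟩ := j
  obtain ⟨i, hi⟩ := i
  simp only [Fin.mk_le_mk] at hij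
  induction j, hij using Nat.le_induction with
  | base => exact le_rfl
  | succ j hij ih => exact (ih (Nat.lt_of_succ_lt hj)).trans (hT ⟨j, _⟩ ⟨j + 1, hj⟩ rfl)

theorem measurable_obs (T : StaticTeam N Ω Ω₀ Y U) : Measurable T.obs :=
  measurable_pi_lambda _ T.measurable_η

theorem measurable_condCost (T : StaticTeam N Ω Ω₀ Y U) (κ : Kernel (∀ k, Y k) Ω₀)
    [IsMarkovKernel κ] :
    Measurable fun p : (∀ k, Y k) × (∀ k, U k) => T.condCost κ p.1 p.2 := by
  refine Measurable.lintegral_kernel_prod_right (κ := κ.comap Prod.fst measurable_fst)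
    (f := fun (p : (∀ k, Y k) × (∀ k, U k)) w => (T.c w p.2 : ℝ≥0∞)) ?_
  exact measurable_coe_nnreal_ennreal.comp (T.measurable_c.comp
    (by fun_prop : Measurable fun q : ((∀ k, Y k) × (∀ k, U k)) × Ω₀ => (q.2, q.1.2)))

/-- Actions are functions of the measurements, so `ω₀` can be integrated out first; what remains is
lower semicontinuous in the actions when `condCost` is. -/
theorem cost_eq_lintegral_condCost (T : StaticTeam N Ω Ω₀ Y U) {κ : Kernel (∀ k, Y k) Ω₀}
    [IsMarkovKernel κ] (hκ : HasCondDistrib T.ω₀ T.obs κ T.P) (γ : T.Policy) :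
    T.cost γ = ∫⁻ ω, T.condCost κ (T.obs ω) (fun k => (γ k).1 (T.η k ω)) ∂T.P := by
  have := T.isProbabilityMeasure
  have hm : Measurable fun p : (∀ k, Y k) × Ω₀ => (T.c p.2 fun k => (γ k).1 (p.1 k) : ℝ≥0∞) := by
    refine measurable_coe_nnreal_ennreal.comp (T.measurable_c.comp (measurable_snd.prodMk ?_))
    exact measurable_pi_lambda _ fun k => (γ k).2.comp ((measurable_pi_apply k).comp measurable_fst)
  have h1 : T.cost γ = ∫⁻ p, (T.c p.2 fun k => (γ k).1 (p.1 k) : ℝ≥0∞)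
      ∂(T.P.map fun ω => (T.obs ω, T.ω₀ ω)) := by
    rw [lintegral_map hm (T.measurable_obs.prodMk T.measurable_ω₀)]
    rfl
  rw [h1, hκ.map_eq, Measure.lintegral_compProd hm,
    lintegral_map hm.lintegral_kernel_prod_right' T.measurable_obs]
  rfl

/-- Independent randomization of the actions does not improve on deterministic policies. -/
theorem iInf_cost_le_randomizedCost [∀ k, StandardBorelSpace (U k)] [∀ k, Nonempty (U k)]
    (T : StaticTeam N Ω Ω₀ Y U) (Q : ∀ k, Kernel (Y k) (U k)) [∀ k, IsMarkovKernel (Q k)] :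
    ⨅ γ : T.Policy, T.cost γ ≤ T.randomizedCost Q := by
  have := T.isProbabilityMeasure
  choose r hr hrQ using fun k => (Q k).exists_measurable_map_eq_unitInterval
  let act : Ω → (Fin N → unitInterval) → ∀ k, U k := fun ω ξ k => r k (T.η k ω) (ξ k)
  have hact : Measurable (Function.uncurry act) :=
    measurable_pi_lambda _ fun k => (hr k).comp
      (((T.measurable_η k).comp measurable_fst).prodMk
        ((measurable_pi_apply k).comp measurable_snd))
  have hc : ∀ ω, Measurable fun u => (T.c (T.ω₀ ω) u : ℝ≥0∞) := fun ω =>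
    measurable_coe_nnreal_ennreal.comp (T.measurable_c.comp measurable_prodMk_left)
  have hpi : ∀ ω, Measure.pi (fun k => Q k (T.η k ω)) =
      (volume : Measure (Fin N → unitInterval)).map (act ω) := by
    intro ω
    have hk : ∀ k, Measurable (r k (T.η k ω)) := fun k => (hr k).comp measurable_prodMk_left
    have hσ : ∀ k, SigmaFinite ((volume : Measure unitInterval).map (r k (T.η k ω))) := fun k => by
      rw [hrQ]; infer_instance
    rw [volume_pi, show act ω = fun ξ k => r k (T.η k ω) (ξ k) from rfl,
      Measure.pi_map_pi fun k => (hk k).aemeasurable]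
    simp only [hrQ]
  have hjoint : Measurable fun p : Ω × (Fin N → unitInterval) =>
      (T.c (T.ω₀ p.1) (act p.1 p.2) : ℝ≥0∞) :=
    measurable_coe_nnreal_ennreal.comp
      (T.measurable_c.comp ((T.measurable_ω₀.comp measurable_fst).prodMk hact))
  have hswap : T.randomizedCost Q =
      ∫⁻ ξ : Fin N → unitInterval, ∫⁻ ω, (T.c (T.ω₀ ω) (act ω ξ) : ℝ≥0∞) ∂T.P := by
    rw [← lintegral_lintegral_swap hjoint.aemeasurable]
    refine lintegral_congr fun ω => ?_
    rw [hpi, lintegral_map (hc ω) hact.of_uncurry_left]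
  obtain ⟨ξ, hξ⟩ := exists_le_lintegral (μ := (volume : Measure (Fin N → unitInterval)))
    ((hjoint.comp measurable_swap).lintegral_prod_right' (ν := T.P)).aemeasurable
  rw [hswap]
  refine le_trans ?_ hξ
  exact iInf_le (fun γ : T.Policy => T.cost γ) fun k =>
    ⟨fun y => r k y (ξ k), (hr k).comp (measurable_id.prodMk measurable_const)⟩

/-- Under nested information, if the actions range over compact spaces and the conditional cost is
lower semicontinuous in the actions, the infimum of the cost is attained. -/
theorem exists_isTeamOptimal [∀ k, TopologicalSpace (U k)] [∀ k, PolishSpace (U k)]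
    [∀ k, BorelSpace (U k)] [∀ k, CompactSpace (U k)] [∀ k, Nonempty (U k)]
    (T : StaticTeam N Ω Ω₀ Y U) (hT : T.IsClassical) {κ : Kernel (∀ k, Y k) Ω₀}
    [IsMarkovKernel κ] (hκ : HasCondDistrib T.ω₀ T.obs κ T.P)
    (hlsc : ∀ y, LowerSemicontinuous (T.condCost κ y)) :
    ∃ γ : T.Policy, T.IsTeamOptimal γ := by
  have := T.isProbabilityMeasure
  let u₀ : ∀ k, U k := fun k => Classical.arbitrary (U k)
  obtain ⟨J, hJanti, hJlim, hJmem⟩ := exists_seq_tendsto_sInf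
    (S := Set.range fun γ : T.Policy => T.cost γ) ⟨_, fun k => ⟨fun _ => u₀ k, measurable_const⟩, rfl⟩
    (OrderBot.bddBelow _)
  choose γ hγ using hJmem
  let x : ℕ → Ω → ∀ k, U k := fun n ω k => (γ n k).1 (T.η k ω)
  have hx : ∀ n, Measurable (x n) := fun n =>
    measurable_pi_lambda _ fun k => (γ n k).2.comp (T.measurable_η k)
  obtain ⟨w, hw, hae⟩ := exists_averageLaw_tendsto_ae T.P hx
  obtain ⟨M, hM, hMlim⟩ := exists_kernel_eq_lim_averageLaw w hx
  have hF : ∀ (j : Fin N) (n : ℕ), ∃ F : Y j → ∀ i, U i, Measurable F ∧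
      ∀ ω, truncate u₀ (j + 1) (x n ω) = F (T.η j ω) := fun j n =>
    exists_truncate_eq_comp (fun i j h => hT.comap_le h) u₀ (fun i => (γ n i).2) j le_rfl
  choose F hFm hFx using hF
  -- Truncation is continuous, hence commutes with the weak limit; this identifies the truncated `M
  -- ω` with `A j` at `y^j`.
  choose A hA hAlim using fun j => exists_kernel_eq_lim_averageLaw w (hFm j)
  have hMA : ∀ j : Fin N, ∀ᵐ ω ∂T.P, (M ω).map (truncate u₀ (j + 1)) = A j (T.η j ω) := by
    intro j
    filter_upwards [hae] with ω ⟨μ, hμ⟩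
    have hc := continuous_truncate u₀ ((j : ℕ) + 1)
    have h1 := ProbabilityMeasure.tendsto_map_of_tendsto_of_continuous _ _ hμ hc
    rw [hMlim ω μ hμ, hAlim j (T.η j ω) _ (h1.congr fun n => ?_)]
    · rfl
    · rw [map_averageLaw _ _ hc.measurable]
      simp only [hFx]
  let V : Ω → (∀ k, U k) → ℝ≥0∞ := fun ω u => T.condCost κ (T.obs ω) u
  have hV : Measurable (Function.uncurry V) :=
    (T.measurable_condCost κ).comp ((T.measurable_obs.comp measurable_fst).prodMk measurable_snd)
  have hVω : ∀ ω, Measurable (V ω) := fun ω => hV.comp measurable_prodMk_left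
  have hVx : Measurable fun p : Ω × ℕ => V p.1 (x p.2 p.1) :=
    measurable_from_prod_countable_left fun n => hV.comp (measurable_id.prodMk (hx n))
  have hcost : ∀ n, ∫⁻ ω, V ω (x n ω) ∂T.P = J n := fun n =>
    (T.cost_eq_lintegral_condCost hκ (γ n)).symm.trans (hγ n)
  obtain ⟨δ, hδ, hδV⟩ := exists_policy_lintegral_le T.P T.measurable_η
    (fun i j h => hT.comap_le h) u₀ M A hMA hV
  refine ⟨fun k => ⟨δ k, hδ k⟩, le_antisymm ?_ (iInf_le _ _)⟩
  calc T.cost (fun k => ⟨δ k, hδ k⟩)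
      = ∫⁻ ω, V ω (fun k => δ k (T.η k ω)) ∂T.P := T.cost_eq_lintegral_condCost hκ _
    _ ≤ ∫⁻ ω, ∫⁻ u, V ω u ∂(M ω) ∂T.P := hδV
    _ ≤ ∫⁻ ω, liminf (fun n => ∫⁻ j, V ω (x j ω) ∂(w n : Measure ℕ)) atTop ∂T.P := by
        refine lintegral_mono_ae ?_
        filter_upwards [hae] with ω ⟨μ, hμ⟩
        rw [hMlim ω μ hμ]
        refine (lintegral_le_liminf_of_lowerSemicontinuous hμ (hlsc (T.obs ω))).trans_eq ?_
        simp only [lintegral_averageLaw _ _ (hVω ω), V]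
    _ ≤ liminf (fun n => ∫⁻ ω, ∫⁻ j, V ω (x j ω) ∂(w n : Measure ℕ) ∂T.P) atTop :=
        lintegral_liminf_le fun n => hVx.lintegral_prod_right'
    _ ≤ liminf J atTop := by
        refine liminf_le_liminf (Eventually.of_forall fun n => ?_)
        rw [lintegral_lintegral_swap hVx.aemeasurable]
        simp only [hcost]
        -- `w n` charges only `j ≥ n`, where the decreasing costs are at most `J n`.
        calc ∫⁻ j, J j ∂(w n : Measure ℕ) ≤ ∫⁻ _, J n ∂(w n : Measure ℕ) :=
              lintegral_mono_ae ((hw n).mono fun j hj => hJanti hj)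
          _ = J n := by simp
    _ = ⨅ γ : T.Policy, T.cost γ := hJlim.liminf_eq

end StaticTeam

theorem mainTheorem8 {N : ℕ} {Ω Ω₀ : Type*} {Y U : Fin N → Type*}
    [MeasurableSpace Ω] [MeasurableSpace Ω₀]
    [∀ k, TopologicalSpace (Y k)] [∀ k, PolishSpace (Y k)]
    [∀ k, MeasurableSpace (Y k)] [∀ k, BorelSpace (Y k)]
    [∀ k, TopologicalSpace (U k)] [∀ k, PolishSpace (U k)]
    [∀ k, MeasurableSpace (U k)] [∀ k, BorelSpace (U k)] [∀ k, Nonempty (U k)]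
    (T : StaticTeam N Ω Ω₀ Y U)
    (hclassical : T.IsClassical)
    (hcompact : CompactSpace (∀ k, Y k × U k))
    (κ : Kernel (∀ k, Y k) Ω₀) [IsMarkovKernel κ]
    (hκ : HasCondDistrib T.ω₀ T.obs κ T.P)
    (hlsc : ∀ y, LowerSemicontinuous (T.condCost κ y))
    (hweak : T.HasWeaklyContinuousKernels) :
    ∃ γ : T.Policy, T.IsTeamOptimal γ ∧
      ∀ Q : ∀ k, Kernel (Y k) (U k), (∀ k, IsMarkovKernel (Q k)) →
        T.cost γ ≤ T.randomizedCost Q := by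
  have := T.isProbabilityMeasure
  -- A sample point makes every `Y k` nonempty, so the product projects onto each `U k`.
  obtain ⟨ω⟩ := nonempty_of_isProbabilityMeasure T.P
  have : ∀ k, CompactSpace (U k) := by
    intro k
    let f : (∀ k, Y k × U k) → U k := fun p => (p k).2
    have hf : Function.Surjective f := fun u =>
      ⟨Function.update (fun i => (T.η i ω, Classical.arbitrary (U i))) k (T.η k ω, u), by simp [f]⟩
    exact hf.compactSpace (by fun_prop)
  obtain ⟨γ, hγ⟩ := T.exists_isTeamOptimal hclassical hκ hlsc
  refine ⟨γ, hγ, fun Q hQ => ?_⟩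
  rw [show T.cost γ = _ from hγ]
  exact T.iInf_cost_le_randomizedCost Q
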